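/- For a positive integer $n$, let the balanced papillon graph $\mathcal{P}_n$ be the simple graph on the $8n$ vertices $u_1,\dots,u_{4n},v_1,\dots,v_{4n}$ whose edges are the following: the edges of the cycle $(u_1,u_2,\dots,u_{4n})$; the edges $u_iv_i$ for $1\le i\le 4n$; the edges $v_{2i-1}v_{2i}$ for $1\le i\le 2n$; the edges $v_{2i-1}v_{2i+2}$ for $1\le i\le 2n-1$ with $i\ne n$; and the two edges $v_2v_{2n+2}$ and $v_{2n-1}v_{4n-1}$. A graph $G$ admitting a perfect matching is said to have the Perfect-Matching-Hamiltonian property (PMH-property) if for every perfect matching $M$ of $G$ there exists a perfect matching $N$ of $G$ such that $M\cup N$ is the edge set of a Hamiltonian cycle of $G$. Theorem. Let $n$ be a positive even integer. Then the balanced papillon graph $\mathcal{P}_n$ has the PMH-property. -/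

import Mathlib

/-- The Perfect-Matching-Hamiltonian property: `G` admits a perfect matching, and for every perfect
matching `M` of `G` there is a perfect matching `N` of `G` such that `M ∪ N` is the edge set of a
Hamiltonian cycle of `G`. -/
def SimpleGraph.IsPMH {V : Type*} [DecidableEq V] (G : SimpleGraph V) : Prop :=
  (∃ M : G.Subgraph, M.IsPerfectMatching) ∧
    ∀ M : G.Subgraph, M.IsPerfectMatching →
      ∃ N : G.Subgraph, N.IsPerfectMatching ∧
        ∃ (a : V) (p : G.Walk a a), p.IsHamiltonianCycle ∧
          {e | e ∈ p.edges} = M.edgeSet ∪ N.edgeSet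

namespace Papillon

/-- The vertex set `{u_i, v_i : 1 ≤ i ≤ 2r + 2ℓ}`. The label `i` runs from `1`, so
`Sum.inl k` is `u_{k+1}` and `Sum.inr k` is `v_{k+1}`. -/
abbrev Vertex (r l : ℕ) : Type := Fin (2 * r + 2 * l) ⊕ Fin (2 * r + 2 * l)

/-- The edges `u_a u_b` of the outer cycle `(u_1, …, u_{2r+2ℓ})`, in terms of the labels. -/
def OuterEdge (r l a b : ℕ) : Prop :=
  b = a + 1 ∨ (a = 2 * r + 2 * l ∧ b = 1)

/-- The edges `v_a v_b` of the inner cycle, in terms of the labels, with `s = min r ℓ`: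
`v_{2i-1} v_{2i}` for `i ∈ [r+ℓ]`; `v_{2i-1} v_{2i+2}` for `i ∈ [r+ℓ-1] \ {s}`;
`v_2 v_{2s+2}`; and `v_{2s-1} v_{2r+2ℓ-1}`. -/
def InnerEdge (r l a b : ℕ) : Prop :=
  (∃ i, 1 ≤ i ∧ i ≤ r + l ∧ a = 2 * i - 1 ∧ b = 2 * i) ∨
  (∃ i, 1 ≤ i ∧ i ≤ r + l - 1 ∧ i ≠ min r l ∧ a = 2 * i - 1 ∧ b = 2 * i + 2) ∨
  (a = 2 ∧ b = 2 * min r l + 2) ∨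
  (a = 2 * min r l - 1 ∧ b = 2 * r + 2 * l - 1)

/-- The listed edges of the papillon graph, each in one orientation: outer edges, inner edges and
the spokes `u_i v_i`. -/
def EdgeRel (r l : ℕ) : Vertex r l → Vertex r l → Prop
  | .inl i, .inl j => OuterEdge r l (i.val + 1) (j.val + 1)
  | .inr i, .inr j => InnerEdge r l (i.val + 1) (j.val + 1)
  | .inl i, .inr j => i = j
  | .inr _, .inl _ => False

end Papillon

/-- The papillon graph `P_{r,ℓ}` (for positive integers `r` and `ℓ`). -/
def papillonGraph (r l : ℕ) : SimpleGraph (Papillon.Vertex r l) :=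
  SimpleGraph.fromRel (Papillon.EdgeRel r l)

/-- The balanced papillon graph `P_n = P_{n,n}`. -/
abbrev balancedPapillonGraph (n : ℕ) : SimpleGraph (Papillon.Vertex n n) :=
  papillonGraph n n

/-! The graph consists of two chains of `n` 4-cycles `u_{2i-1} u_{2i} v_{2i} v_{2i-1}`. Two opposite
corners of a 4-cycle form an end, and every vertex has one external edge, leaving its 4-cycle. In a
perfect matching `M`, the number of vertices matched externally is the same at every end: 0, 1 or 2
(`matching_trichotomy`). A perfect matching disjoint from `M` completes it as soon as the union is
connected. Two: add internal edges, crossing (that is, using the spokes of) a single 4-cycle. Zero: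
if one chain is crossed oddly often, add all external edges. Otherwise add one external edge per
end, changing level (outer or inner) exactly at uncrossed 4-cycles; as `n` is even, each chain
starts and finishes on the outer level, so the choices fit together. One: in each 4-cycle add the
pair of opposite edges that avoids the edge of `M`. -/

namespace SimpleGraph

open scoped symmDiff

variable {V : Type*} {G : SimpleGraph V}

/-! ### From pairs of involutions to Hamiltonian cycles. -/

/-- The perfect matching formed by the edges `{v, f v}` for an involution `f` along edges of `G`. -/
def matchingOfInvolution (f : V → V) (hf : Function.Involutive f) (hadj : ∀ v, G.Adj v (f v)) :
    G.Subgraph where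
  verts := Set.univ
  Adj v w := w = f v
  adj_sub := by rintro v _ rfl; exact hadj v
  edge_vert _ := trivial
  symm := ⟨by rintro v _ rfl; exact (hf v).symm⟩

theorem matchingOfInvolution_isPerfectMatching (f : V → V) (hf : Function.Involutive f)
    (hadj : ∀ v, G.Adj v (f v)) : (matchingOfInvolution f hf hadj).IsPerfectMatching :=
  Subgraph.isPerfectMatching_iff.2 fun v ↦ ⟨f v, rfl, fun _ h ↦ h⟩

theorem Subgraph.IsPerfectMatching.exists_involution {M : G.Subgraph} (hM : M.IsPerfectMatching) :
    ∃ f : V → V, Function.Involutive f ∧ (∀ v, G.Adj v (f v)) ∧ ∀ v w, M.Adj v w ↔ w = f v := by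
  choose f hf hu using Subgraph.isPerfectMatching_iff.1 hM
  exact ⟨f, fun v ↦ (hu _ _ (hf v).symm).symm, fun v ↦ (hf v).adj_sub,
    fun v w ↦ ⟨hu v w, by rintro rfl; exact hf v⟩⟩

/-- Disjointness turns the symmetric difference into the union, which is 2-regular; being connected,
it is a single cycle. -/
theorem exists_isHamiltonianCycle_of_preconnected_symmDiff [Finite V] [DecidableEq V] [Nonempty V]
    {M N : G.Subgraph} (hM : M.IsPerfectMatching) (hN : N.IsPerfectMatching)
    (hdisj : ∀ v w, M.Adj v w → ¬ N.Adj v w)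
    (hconn : (M.spanningCoe ∆ N.spanningCoe).Preconnected) :
    ∃ (a : V) (p : G.Walk a a), p.IsHamiltonianCycle ∧
      {e | e ∈ p.edges} = M.edgeSet ∪ N.edgeSet := by
  classical
  have := Fintype.ofFinite V
  set K := M.spanningCoe ∆ N.spanningCoe with hK
  have hKadj : ∀ v w, K.Adj v w ↔ M.Adj v w ∨ N.Adj v w := by
    intro v w
    have := hdisj v w
    simp only [hK, symmDiff_def, sup_adj, sdiff_adj, Subgraph.spanningCoe_adj]
    tauto
  have hcyc : K.IsCycles := hM.symmDiff_isCycles hN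
  obtain ⟨a⟩ := ‹Nonempty V›
  obtain ⟨b, hb, -⟩ := Subgraph.isPerfectMatching_iff.1 hM a
  obtain ⟨p, hp, hverts⟩ := hcyc.exists_cycle_toSubgraph_verts_eq_connectedComponentSupp
    (v := a) (c := K.connectedComponentMk a) rfl ⟨b, (hKadj a b).2 (Or.inl hb)⟩
  have hall : ∀ v, v ∈ p.toSubgraph.verts := fun v ↦ by
    rw [hverts, ConnectedComponent.mem_supp_iff, ConnectedComponent.eq]
    exact hconn v a
  have hle : K ≤ G := fun v w h ↦ ((hKadj v w).1 h).elim (·.adj_sub) (·.adj_sub)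
  refine ⟨a, p.mapLe hle, ?_, ?_⟩
  · rw [Walk.isHamiltonianCycle_iff_isCycle_and_support_count_tail_eq_one]
    refine ⟨hp.mapLe hle, fun v ↦ ?_⟩
    rw [Walk.support_mapLe_eq_support]
    refine List.count_eq_one_of_mem hp.support_nodup ?_
    have hv := p.mem_verts_toSubgraph.1 (hall v)
    rw [← Walk.cons_tail_support] at hv
    rcases List.mem_cons.1 hv with rfl | hv
    · exact Walk.end_mem_tail_support hp.not_nil
    · exact hv
  · ext e
    induction e with
    | h v w =>
      simp only [Set.mem_ofPred_eq, Walk.edges_mapLe_eq_edges, Set.mem_union, Subgraph.mem_edgeSet]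
      rw [← hKadj, ← hp.adj_toSubgraph_iff_of_isCycles hcyc (hall v) w,
        ← Subgraph.mem_edgeSet, Walk.mem_edges_toSubgraph]

/-- A graph has the PMH-property if every fixed-point-free involution `f` along edges can be
completed by a disjoint one `g` so that `f` and `g` together act transitively. -/
theorem isPMH_of_involutions [Finite V] [DecidableEq V] [Nonempty V]
    (h₀ : ∃ f : V → V, Function.Involutive f ∧ ∀ v, G.Adj v (f v))
    (h : ∀ f : V → V, Function.Involutive f → (∀ v, G.Adj v (f v)) →
      ∃ g : V → V, Function.Involutive g ∧ (∀ v, G.Adj v (g v)) ∧ (∀ v, f v ≠ g v) ∧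
        ∀ r : Setoid V, (∀ v, r v (f v)) → (∀ v, r v (g v)) → ∀ v w, r v w) :
    G.IsPMH := by
  obtain ⟨f₀, hf₀, hadj₀⟩ := h₀
  refine ⟨⟨_, matchingOfInvolution_isPerfectMatching f₀ hf₀ hadj₀⟩, fun M hM ↦ ?_⟩
  obtain ⟨f, hf, hfG, hfM⟩ := hM.exists_involution
  obtain ⟨g, hg, hgG, hfg, hconn⟩ := h f hf hfG
  have hN := matchingOfInvolution_isPerfectMatching g hg hgG
  refine ⟨_, hN, exists_isHamiltonianCycle_of_preconnected_symmDiff hM hN ?_ ?_⟩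
  · rintro v w hM rfl
    exact hfg v ((hfM _ _).1 hM).symm
  · refine hconn (reachableSetoid _) (fun v ↦ Adj.reachable ?_) (fun v ↦ Adj.reachable ?_)
    · simp only [symmDiff_def, sup_adj, sdiff_adj, Subgraph.spanningCoe_adj]
      exact Or.inl ⟨(hfM _ _).2 rfl, hfg v⟩
    · simp only [symmDiff_def, sup_adj, sdiff_adj, Subgraph.spanningCoe_adj]
      exact Or.inr ⟨rfl, fun h ↦ hfg v ((hfM _ _).1 h).symm⟩

end SimpleGraph

/-! ### Chains of 4-cycles in coordinates. -/

namespace Papillon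

/-- Coordinates `(s, j, e, t)` on the vertices of the balanced papillon graph: the side `s`, the
4-cycle `j` in the chain on that side, the end `e` of the chain (`true` for the later one) to which
the external edge of the vertex points, and whether the vertex lies on the outer cycle when
`t = true`, or on the inner one. -/
abbrev Coord (n : ℕ) : Type := Bool × Fin n × Bool × Bool

variable {n : ℕ}

/-- The other endpoint of the edge leaving the 4-cycle of a vertex. -/
def extPartner : Coord n → Coord n
  | (s, j, false, t) =>
    if j.val = 0 then
      if t then (!s, ⟨n - 1, Nat.sub_one_lt_of_lt j.2⟩, true, true) else (!s, j, false, false)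
    else (s, ⟨j - 1, by omega⟩, true, t)
  | (s, j, true, t) =>
    if h : j.val + 1 < n then (s, ⟨j + 1, h⟩, false, t)
    else if t then (!s, ⟨0, j.pos⟩, false, true) else (!s, j, true, false)

/-- Adjacency in coordinates. -/
def Nbr (x y : Coord n) : Prop :=
  y = extPartner x ∨ ∃ t, y = (x.1, x.2.1, !x.2.2.1, t)

/-- The involution inside the 4-cycles that is crossed exactly where `p` holds. -/
def blockPartner (p : Bool → ℕ → Bool) : Coord n → Coord n
  | (s, j, e, t) => (s, j, !e, t ^^ p s j)

/-- The parity of the number of `i < j` with `p i`. -/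
def parity (p : ℕ → Bool) : ℕ → Bool
  | 0 => false
  | j + 1 => parity p j ^^ p j

/-- Complementing flips each of the `j` summands, so an even `j` leaves the parity unchanged. -/
theorem parity_not (p : ℕ → Bool) (j : ℕ) :
    parity (fun i ↦ !p i) j = (parity p j ^^ j.bodd) := by
  induction j with
  | zero => rfl
  | succ j ih =>
    simp only [parity, ih, Nat.bodd_succ]
    cases parity p j <;> cases p j <;> cases j.bodd <;> rfl

theorem extPartner_involutive : Function.Involutive (extPartner (n := n)) := by
  rintro ⟨s, ⟨j, hj⟩, e, t⟩
  cases e <;> cases t <;> simp only [extPartner] <;> split_ifs <;>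
    simp_all [Fin.ext_iff, Nat.sub_add_cancel, Nat.one_le_iff_ne_zero] <;> omega

theorem extPartner_succ (s t : Bool) (j : ℕ) (h : j + 1 < n) :
    extPartner (s, ⟨j, by omega⟩, true, t) = (s, ⟨j + 1, h⟩, false, t) := by
  simp [extPartner, h]

theorem extPartner_zero_true (s : Bool) (h : 0 < n) :
    extPartner (s, ⟨0, h⟩, false, true) = (!s, ⟨n - 1, by omega⟩, true, true) := by
  simp [extPartner]

theorem extPartner_zero_false (s : Bool) (h : 0 < n) :
    extPartner (s, ⟨0, h⟩, false, false) = (!s, ⟨0, h⟩, false, false) := by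
  simp [extPartner]

theorem extPartner_last_false (s : Bool) (h : 0 < n) :
    extPartner (s, ⟨n - 1, Nat.sub_one_lt_of_lt h⟩, true, false) =
      (!s, ⟨n - 1, Nat.sub_one_lt_of_lt h⟩, true, false) := by
  simp [extPartner, Nat.sub_add_cancel h]

theorem extPartner_ne_inner (s e t t' : Bool) (j : Fin n) :
    extPartner (s, j, e, t) ≠ (s, j, !e, t') := by
  obtain ⟨j, hj⟩ := j
  cases e <;> cases t <;> simp only [extPartner] <;> split_ifs <;>
    simp [Fin.ext_iff] <;> omega

theorem blockPartner_involutive (p : Bool → ℕ → Bool) :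
    Function.Involutive (blockPartner (n := n) p) := by
  rintro ⟨s, j, e, t⟩
  simp [blockPartner]

theorem nbr_blockPartner (p : Bool → ℕ → Bool) (x : Coord n) : Nbr x (blockPartner p x) :=
  Or.inr ⟨_, rfl⟩

theorem exists_inner_of_ne_extPartner {f : Coord n → Coord n} (hN : ∀ x, Nbr x (f x))
    {s e t : Bool} {j : Fin n} (h : f (s, j, e, t) ≠ extPartner (s, j, e, t)) :
    ∃ t', f (s, j, e, t) = (s, j, !e, t') :=
  (hN _).resolve_left h

/-! ### Connectedness criteria. -/

/-- The external edges together with an internal matching that crosses oddly often on one side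
connect everything. -/
theorem connected_extPartner_blockPartner (p : Bool → ℕ → Bool) {s₀ : Bool}
    (hp : parity (p s₀) n = true) (r : Setoid (Coord n)) (hext : ∀ x, r x (extPartner x))
    (hblk : ∀ x, r x (blockPartner p x)) (x y : Coord n) : r x y := by
  have hn : 0 < n := x.2.1.pos
  -- On each chain the edges form two paths from the first end to the last, swapping levels when the
  -- parity is odd. The links between the chains then join these four paths.
  have hleft : ∀ s t j (hj : j < n),
      r (s, ⟨0, hn⟩, false, t) (s, ⟨j, hj⟩, false, t ^^ parity (p s) j) := by
    intro s t j
    induction j with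
    | zero => simp [parity]
    | succ j ih =>
      intro hj
      refine r.trans (ih (by omega)) (r.trans (hblk _) ?_)
      have := hext (s, ⟨j, by omega⟩, true, t ^^ parity (p s) (j + 1))
      rw [extPartner_succ s _ j hj] at this
      simpa [blockPartner, parity] using this
  have hright : ∀ s t j (hj : j < n),
      r (s, ⟨0, hn⟩, false, t) (s, ⟨j, hj⟩, true, t ^^ parity (p s) (j + 1)) := by
    intro s t j hj
    refine r.trans (hleft s t j hj) ?_
    simpa [blockPartner, parity] using hblk (s, ⟨j, hj⟩, false, t ^^ parity (p s) j)
  have hlast : ∀ s t,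
      r (s, ⟨0, hn⟩, false, t) (s, ⟨n - 1, by omega⟩, true, t ^^ parity (p s) n) := by
    intro s t
    simpa [Nat.sub_add_cancel hn] using hright s t (n - 1) (by omega)
  have hbot : ∀ s, r (s, ⟨0, hn⟩, false, false) (!s, ⟨0, hn⟩, false, false) := by
    intro s
    simpa [extPartner_zero_false] using hext (s, ⟨0, hn⟩, false, false)
  have htop : ∀ s, r (!s, ⟨0, hn⟩, false, true) (s, ⟨0, hn⟩, false, !parity (p s) n) := by
    intro s
    refine r.trans (hext _) (r.symm ?_)
    rw [extPartner_zero_true]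
    simpa using hlast s (!parity (p s) n)
  have h₁ : r (!s₀, ⟨0, hn⟩, false, true) (s₀, ⟨0, hn⟩, false, false) := by
    simpa [hp] using htop s₀
  have h₂ : r (s₀, ⟨0, hn⟩, false, true) (s₀, ⟨0, hn⟩, false, false) := by
    have := htop (!s₀)
    rw [Bool.not_not] at this
    refine r.trans this ?_
    cases parity (p !s₀) n
    · exact h₁
    · exact r.symm (hbot s₀)
  have hstart : ∀ s t, r (s, ⟨0, hn⟩, false, t) (s₀, ⟨0, hn⟩, false, false) := by
    intro s t
    obtain rfl | rfl : s = s₀ ∨ s = !s₀ := by cases s <;> cases s₀ <;> simp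
    · cases t
      · exact r.refl _
      · exact h₂
    · cases t
      · exact r.symm (hbot s₀)
      · exact h₁
  have hall : ∀ z, r z (s₀, ⟨0, hn⟩, false, false) := by
    rintro ⟨s, ⟨j, hj⟩, e, t⟩
    cases e
    · refine r.trans (r.symm ?_) (hstart s (t ^^ parity (p s) j))
      simpa using hleft s (t ^^ parity (p s) j) j hj
    · refine r.trans (r.symm ?_) (hstart s (t ^^ parity (p s) (j + 1)))
      simpa using hright s (t ^^ parity (p s) (j + 1)) j hj
  exact r.trans (hall x) (r.symm (hall y))

/-- An internal matching together with a disjoint matching that uses exactly one external edge at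
each end of each 4-cycle connect everything. -/
theorem connected_blockPartner_of_single {p : Bool → ℕ → Bool} {g : Coord n → Coord n}
    (hgN : ∀ x, Nbr x (g x)) (hne : ∀ x, blockPartner p x ≠ g x)
    (hsingle : ∀ s j e, g (s, j, e, true) = extPartner (s, j, e, true) ↔
      g (s, j, e, false) ≠ extPartner (s, j, e, false))
    (r : Setoid (Coord n)) (hblk : ∀ x, r x (blockPartner p x)) (hgr : ∀ x, r x (g x))
    (x y : Coord n) : r x y := by
  have hn : 0 < n := x.2.1.pos
  have hexists : ∀ s j e, ∃ t, g (s, j, e, t) = extPartner (s, j, e, t) := by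
    intro s j e
    by_cases h : g (s, j, e, true) = extPartner (s, j, e, true)
    · exact ⟨_, h⟩
    · exact ⟨false, not_not.1 fun h' ↦ h ((hsingle s j e).2 h')⟩
  have hmiss : ∀ s j e, ∃ t, g (s, j, e, t) ≠ extPartner (s, j, e, t) := by
    intro s j e
    by_cases h : g (s, j, e, true) = extPartner (s, j, e, true)
    · exact ⟨_, (hsingle s j e).1 h⟩
    · exact ⟨_, h⟩
  -- The two block edges and the single internal edge of `g`, distinct from them, form a path
  -- through all four vertices.
  have hblock : ∀ s j, ∃ z, ∀ e t, r (s, j, e, t) z := by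
    intro s j
    obtain ⟨t₀, ht₀⟩ := hmiss s j false
    obtain ⟨t₁, ht₁⟩ := exists_inner_of_ne_extPartner hgN ht₀
    have hd := hne (s, j, false, t₀)
    rw [ht₁] at hd
    have h₁ := hgr (s, j, false, t₀)
    rw [ht₁] at h₁
    have h₂ := hblk (s, j, false, t₀)
    have h₃ := hblk (s, j, true, t₁)
    have hp : p s j = !(t₀ ^^ t₁) := by
      revert hd
      simp only [blockPartner]
      cases p s j <;> cases t₀ <;> cases t₁ <;> simp
    simp only [blockPartner, hp, Bool.not_false, Bool.not_true] at h₁ h₂ h₃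
    refine ⟨(s, j, false, t₀), fun e t ↦ ?_⟩
    have h₄ := r.symm (r.trans h₁ h₃)
    have h₁' := r.symm h₁
    have h₂' := r.symm h₂
    have h₀ := r.refl (s, j, false, t₀)
    cases e <;> cases t <;> cases t₀ <;> cases t₁ <;> assumption
  have hblock' : ∀ s j e t e' t', r (s, j, e, t) (s, j, e', t') := by
    intro s j e t e' t'
    obtain ⟨z, hz⟩ := hblock s j
    exact r.trans (hz _ _) (r.symm (hz _ _))
  have hside : ∀ s j (hj : j < n) e t e' t', r (s, ⟨j, hj⟩, e, t) (s, ⟨0, hn⟩, e', t') := by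
    intro s j
    induction j with
    | zero => exact fun _ ↦ hblock' _ _
    | succ j ih =>
      intro hj e t e' t'
      obtain ⟨t₁, ht₁⟩ := hexists s ⟨j, by omega⟩ true
      have := hgr (s, ⟨j, by omega⟩, true, t₁)
      rw [ht₁, extPartner_succ s _ j hj] at this
      exact r.trans (hblock' _ _ _ _ _ _) (r.trans (r.symm this) (ih _ _ _ _ _))
  have hcross : ∀ z, r z (true, ⟨0, hn⟩, false, true) := by
    rintro ⟨s, ⟨j, hj⟩, e, t⟩
    cases s
    · obtain ⟨t₁, ht₁⟩ := hexists false ⟨0, hn⟩ false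
      have := hgr (false, ⟨0, hn⟩, false, t₁)
      rw [ht₁] at this
      refine r.trans (hside _ _ _ _ _ _ _) (r.trans this ?_)
      cases t₁
      · rw [extPartner_zero_false]; exact hside _ _ _ _ _ _ _
      · rw [extPartner_zero_true]; exact hside _ _ _ _ _ _ _
    · exact hside _ _ _ _ _ _ _
  exact r.trans (hcross x) (r.symm (hcross y))

/-! ### Matchings with one external edge per end, and the trichotomy. -/

/-- The involution that uses the external edge at the vertices selected by `lev`, and inside each
4-cycle the edge between the two other vertices. -/
def levelPartner (lev : Bool → ℕ → Bool → Bool) : Coord n → Coord n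
  | (s, j, e, t) =>
    if t = lev s j e then extPartner (s, j, e, t) else (s, j, !e, !lev s j !e)

theorem levelPartner_mk (lev : Bool → ℕ → Bool → Bool) (s e t : Bool) (j : Fin n) :
    levelPartner lev (s, j, e, t) =
      if t = lev s j e then extPartner (s, j, e, t) else (s, j, !e, !lev s j !e) := rfl

/-- The conditions close the selected vertices under `extPartner`: at the extremes, level `true`
selects the outer edges, which join the last 4-cycle of one chain to the first of the other. -/
theorem levelPartner_involutive {lev : Bool → ℕ → Bool → Bool}
    (hsucc : ∀ s j, lev s (j + 1) false = lev s j true)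
    (hzero : ∀ s, lev s 0 false = true) (hlast : ∀ s, lev s (n - 1) true = true) :
    Function.Involutive (levelPartner (n := n) lev) := by
  have hinv : ∀ (s : Bool) (j : Fin n) (e t : Bool), t = lev s j e →
      (extPartner (s, j, e, t)).2.2.2 = lev (extPartner (s, j, e, t)).1
        (extPartner (s, j, e, t)).2.1 (extPartner (s, j, e, t)).2.2.1 := by
    rintro s ⟨j, hj⟩ e t ht
    cases e
    · rcases j with _ | j
      · simp only [hzero] at ht
        subst ht
        simp [extPartner, hlast]
      · simpa [extPartner, ← hsucc] using ht
    · by_cases h : j + 1 < n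
      · simpa [extPartner, h, hsucc] using ht
      · obtain rfl : j = n - 1 := by omega
        simp only [hlast] at ht
        subst ht
        simp [extPartner, h, hzero]
  rintro ⟨s, j, e, t⟩
  by_cases h : t = lev s j e
  · have h₁ := hinv s j e t h
    have h₂ := extPartner_involutive (s, j, e, t)
    rw [levelPartner_mk lev s e t j, if_pos h]
    generalize extPartner (s, j, e, t) = z at h₁ h₂ ⊢
    obtain ⟨s', j', e', t'⟩ := z
    rw [levelPartner_mk, if_pos h₁, h₂]
  · rw [levelPartner_mk lev s e t j, if_neg h, levelPartner_mk, if_neg (by simp)]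
    simp [Bool.eq_not.2 h]

theorem nbr_levelPartner (lev : Bool → ℕ → Bool → Bool) (x : Coord n) :
    Nbr x (levelPartner lev x) := by
  obtain ⟨s, j, e, t⟩ := x
  rw [levelPartner_mk]
  split_ifs
  · exact Or.inl rfl
  · exact Or.inr ⟨_, rfl⟩

theorem levelPartner_eq_extPartner_iff (lev : Bool → ℕ → Bool → Bool) (s e t : Bool) (j : Fin n) :
    levelPartner lev (s, j, e, t) = extPartner (s, j, e, t) ↔ t = lev s j e := by
  rw [levelPartner_mk]
  split_ifs with h
  · simp [h]
  · simpa [h] using (extPartner_ne_inner s e t _ j).symm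

/-- Internal edges pair the remaining vertices of one end with those of the other, and an external
edge counts at both its endpoints, so the count per end propagates along a chain. -/
theorem matching_trichotomy {f : Coord n → Coord n} (hf : Function.Involutive f)
    (hN : ∀ x, Nbr x (f x)) :
    (∀ x, f x = extPartner x) ∨ (∀ x, f x ≠ extPartner x) ∨
      ∀ s j e, f (s, j, e, true) = extPartner (s, j, e, true) ↔
        f (s, j, e, false) ≠ extPartner (s, j, e, false) := by
  classical
  rcases Nat.eq_zero_or_pos n with rfl | hn
  · exact Or.inl fun x ↦ x.2.1.elim0
  let u : Coord n → ℕ := fun x ↦ if f x = extPartner x then 1 else 0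
  have hu : ∀ x, u x = 0 ∧ f x ≠ extPartner x ∨ u x = 1 ∧ f x = extPartner x := by
    intro x
    by_cases h : f x = extPartner x <;> simp [u, h]
  have huext : ∀ x, u (extPartner x) = u x := by
    intro x
    have : f (extPartner x) = extPartner (extPartner x) ↔ f x = extPartner x := by
      rw [extPartner_involutive x, hf.eq_iff, eq_comm]
    simp only [u, this]
  let c : Bool → Fin n → Bool → ℕ := fun s j e ↦ u (s, j, e, true) + u (s, j, e, false)
  have hinner : ∀ s j e t t', f (s, j, e, t) = (s, j, !e, t') → u (s, j, e, t) = 0 ∧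
      u (s, j, !e, t') = 0 := by
    intro s j e t t' h
    constructor
    · exact if_neg fun h' ↦ extPartner_ne_inner s e t t' j (h'.symm.trans h)
    · refine if_neg fun h' ↦ extPartner_ne_inner s (!e) t' t j ?_
      rw [← h', ← h, hf, Bool.not_not]
  -- Vertices at end `e` without external matching edge inject into such vertices at the other end.
  have hle : ∀ s j e, c s j (!e) ≤ c s j e := by
    intro s j e
    have h₁ := hu (s, j, e, true)
    have h₂ := hu (s, j, e, false)
    have h₃ := hu (s, j, !e, true)
    have h₄ := hu (s, j, !e, false)
    simp only [c]
    rcases h₁ with ⟨h₁, h₁'⟩ | ⟨h₁, -⟩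
    · obtain ⟨t, ht⟩ := exists_inner_of_ne_extPartner hN h₁'
      have ht0 := (hinner _ _ _ _ _ ht).2
      rcases h₂ with ⟨h₂, h₂'⟩ | ⟨h₂, -⟩
      · obtain ⟨t', ht'⟩ := exists_inner_of_ne_extPartner hN h₂'
        have ht0' := (hinner _ _ _ _ _ ht').2
        have hne : t ≠ t' := by
          rintro rfl
          have := hf.injective (ht.trans ht'.symm)
          simp at this
        cases t <;> cases t' <;> simp_all
      · cases t <;> omega
    · rcases h₂ with ⟨h₂, h₂'⟩ | ⟨h₂, -⟩
      · obtain ⟨t', ht'⟩ := exists_inner_of_ne_extPartner hN h₂'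
        have ht0' := (hinner _ _ _ _ _ ht').2
        cases t' <;> omega
      · omega
  have hflip : ∀ s j, c s j true = c s j false :=
    fun s j ↦ le_antisymm (hle s j false) (hle s j true)
  have hside : ∀ s j (hj : j < n), c s ⟨j, hj⟩ false = c s ⟨0, hn⟩ false := by
    intro s j
    induction j with
    | zero => exact fun _ ↦ rfl
    | succ j ih =>
      intro hj
      rw [← ih (by omega), ← hflip s ⟨j, _⟩]
      simp only [c]
      rw [← huext (s, ⟨j, _⟩, true, true), ← huext (s, ⟨j, _⟩, true, false),
        extPartner_succ s _ j hj, extPartner_succ s _ j hj]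
  have hconst : ∀ s j e, c s j e = c true ⟨0, hn⟩ false := by
    have hlast : ∀ s, c s ⟨n - 1, Nat.sub_one_lt_of_lt hn⟩ true = c s ⟨0, hn⟩ false :=
      fun s ↦ (hflip _ _).trans (hside _ _ _)
    -- Let `a`, `a'` be the values of `u` on the outer links at the two chain starts, `b`, `d` those
    -- on the inner links at the first and last ends. Comparing the ends of each chain gives `a + b
    -- = a' + d` and `a' + b = a + d`, so `a = a'`.
    have hswap : c false ⟨0, hn⟩ false = c true ⟨0, hn⟩ false := by
      have h₁ := hlast true
      have h₂ := hlast false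
      have h₃ := huext (true, ⟨0, hn⟩, false, true)
      have h₄ := huext (false, ⟨0, hn⟩, false, true)
      have h₅ := huext (true, ⟨0, hn⟩, false, false)
      have h₆ := huext (true, ⟨n - 1, Nat.sub_one_lt_of_lt hn⟩, true, false)
      rw [extPartner_zero_true] at h₃ h₄
      rw [extPartner_zero_false] at h₅
      rw [extPartner_last_false _ hn] at h₆
      simp only [c, Bool.not_true, Bool.not_false] at *
      omega
    rintro s ⟨j, hj⟩ e
    have : c s ⟨j, hj⟩ e = c s ⟨0, hn⟩ false := by
      cases e
      · exact hside s j hj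
      · exact (hflip _ _).trans (hside s j hj)
    rw [this]
    cases s
    · exact hswap
    · rfl
  have hk : c true ⟨0, hn⟩ false = 2 ∨ c true ⟨0, hn⟩ false = 0 ∨ c true ⟨0, hn⟩ false = 1 := by
    have h₁ := hu (true, ⟨0, hn⟩, false, true)
    have h₂ := hu (true, ⟨0, hn⟩, false, false)
    simp only [c]
    omega
  refine hk.imp (fun h ↦ ?_) (Or.imp (fun h ↦ ?_) fun h ↦ ?_)
  · rintro ⟨s, j, e, t⟩
    have h' := hconst s j e
    have h₁ := hu (s, j, e, true)
    have h₂ := hu (s, j, e, false)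
    simp only [h, c] at h'
    cases t
    · exact (h₂.resolve_left (by omega)).2
    · exact (h₁.resolve_left (by omega)).2
  · rintro ⟨s, j, e, t⟩
    have h' := hconst s j e
    have h₁ := hu (s, j, e, true)
    have h₂ := hu (s, j, e, false)
    simp only [h, c] at h'
    cases t
    · exact (h₂.resolve_right (by omega)).2
    · exact (h₁.resolve_right (by omega)).2
  · intro s j e
    have h' := hconst s j e
    have h₁ := hu (s, j, e, true)
    have h₂ := hu (s, j, e, false)
    simp only [h, c] at h'
    rcases h₁ with ⟨h₁, h₁'⟩ | ⟨h₁, h₁'⟩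
    · simp only [h₁', false_iff, not_not]
      exact (h₂.resolve_left (by omega)).2
    · simp only [h₁', true_iff]
      exact (h₂.resolve_right (by omega)).2

theorem blockPartner_ne_extPartner (p : Bool → ℕ → Bool) (x : Coord n) :
    blockPartner p x ≠ extPartner x :=
  (extPartner_ne_inner _ _ _ _ _).symm

/-- A matching without external edges crosses exactly some of the 4-cycles. -/
theorem exists_eq_blockPartner {f : Coord n → Coord n} (hf : Function.Involutive f)
    (hN : ∀ x, Nbr x (f x)) (hint : ∀ x, f x ≠ extPartner x) :
    ∃ p, f = blockPartner p := by
  choose τ hτ using fun s j e t ↦ exists_inner_of_ne_extPartner hN (hint (s, j, e, t))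
  -- One image determines the whole involution on a 4-cycle; the value beyond `n` is a dummy.
  refine ⟨fun s j ↦ if h : j < n then !τ s ⟨j, h⟩ false true else false, ?_⟩
  have hinv : ∀ s j e t, τ s j (!e) (τ s j e t) = t := by
    intro s j e t
    have := hf (s, j, e, t)
    rw [hτ, hτ] at this
    simpa using this
  ext1 ⟨s, j, e, t⟩
  rw [hτ]
  have hcross : ∀ T : Bool → Bool → Bool, (∀ e t, T (!e) (T e t) = t) →
      ∀ e t, T e t = (t ^^ !T false true) := by decide
  simp only [blockPartner, j.2, dite_true, Fin.eta]
  rw [hcross (τ s j) (hinv s j) e t]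

/-- Every perfect matching, given as an involution, is completed by a disjoint one such that both
together connect all vertices. -/
theorem exists_complementary_involution (hn : 0 < n) (heven : Even n) {f : Coord n → Coord n}
    (hf : Function.Involutive f) (hN : ∀ x, Nbr x (f x)) :
    ∃ g : Coord n → Coord n, Function.Involutive g ∧ (∀ x, Nbr x (g x)) ∧ (∀ x, f x ≠ g x) ∧
      ∀ r : Setoid (Coord n), (∀ x, r x (f x)) → (∀ x, r x (g x)) → ∀ x y, r x y := by
  rcases matching_trichotomy hf hN with h | h | h
  · obtain rfl : f = extPartner := funext h
    -- Crossing only the first 4-cycle makes the parity odd.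
    let p : Bool → ℕ → Bool := fun s j ↦ j == 0
    have hp : ∀ m, parity (p true) (m + 1) = true := by
      intro m
      induction m with
      | zero => rfl
      | succ m ih => rw [parity, ih]; rfl
    refine ⟨blockPartner p, blockPartner_involutive p, nbr_blockPartner p,
      fun x ↦ (blockPartner_ne_extPartner p x).symm, ?_⟩
    refine connected_extPartner_blockPartner p (s₀ := true) ?_
    obtain ⟨m, rfl⟩ := Nat.exists_eq_succ_of_ne_zero hn.ne'
    exact hp m
  · obtain ⟨p, rfl⟩ := exists_eq_blockPartner hf hN h
    by_cases hp : ∃ s, parity (p s) n = true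
    · obtain ⟨s, hs⟩ := hp
      exact ⟨extPartner, extPartner_involutive, fun x ↦ Or.inl rfl, h,
        fun r h₁ h₂ ↦ connected_extPartner_blockPartner p hs r h₂ h₁⟩
    · push Not at hp
      -- The level starts at `true` and changes exactly where `p` does not cross, so the remaining
      -- internal edge is never one of `blockPartner p`.
      let lev : Bool → ℕ → Bool → Bool := fun s j e ↦ !parity (fun i ↦ !p s i) (j + e.toNat)
      have hlev : ∀ s j, lev s j true = (lev s j false ^^ !p s j) := by
        intro s j
        simp only [lev, Bool.toNat_true, Bool.toNat_false, parity, Nat.add_zero]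
        cases parity (fun i ↦ !p s i) j <;> cases p s j <;> rfl
      have hne : ∀ x : Coord n, blockPartner p x ≠ levelPartner lev x := by
        rintro ⟨s, j, e, t⟩
        rw [levelPartner_mk]
        split_ifs with ht
        · exact blockPartner_ne_extPartner p _
        · have := hlev s j
          rw [Bool.eq_not.2 ht]
          simp only [blockPartner, ne_eq, Prod.mk.injEq, true_and]
          cases e <;> simp only [Bool.not_true, Bool.not_false, this] <;>
            cases lev s j false <;> cases p s j <;> simp
      refine ⟨levelPartner lev, levelPartner_involutive (fun _ _ ↦ rfl) (fun _ ↦ rfl) (fun s ↦ ?_),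
        nbr_levelPartner lev, hne, connected_blockPartner_of_single (nbr_levelPartner lev) hne ?_⟩
      -- Evenly many crossed 4-cycles out of an even `n` leave evenly many uncrossed ones, so the
      -- level returns to `true`.
      · have hb : n.bodd = false := by
          obtain ⟨m, rfl⟩ := heven
          simp
        simp only [lev, Bool.toNat_true, Nat.sub_add_cancel hn, parity_not, hb, Bool.xor_false]
        simpa using hp s
      · intro s j e
        rw [levelPartner_eq_extPartner_iff, ne_eq, levelPartner_eq_extPartner_iff]
        cases lev s j e <;> simp
  · have hp : ∃ p : Bool → ℕ → Bool, ∀ x, blockPartner p x ≠ f x := by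
      -- `f` has exactly one edge inside the 4-cycle; `q` selects the internal matching omitting it.
      have hmiss : ∀ s j, ∃ q : Bool, ∀ e t, f (s, j, e, t) ≠ (s, j, !e, t ^^ q) := by
        intro s j
        obtain ⟨t₀, h₀⟩ : ∃ t, f (s, j, false, t) ≠ extPartner (s, j, false, t) := by
          by_cases ht : f (s, j, false, true) = extPartner (s, j, false, true)
          · exact ⟨_, (h s j false).1 ht⟩
          · exact ⟨_, ht⟩
        obtain ⟨t₁, h₁⟩ := exists_inner_of_ne_extPartner hN h₀
        have huniq : ∀ t t', f (s, j, false, t) = (s, j, true, t') → t = t₀ ∧ t' = t₁ := by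
          intro t t' ht
          have hne : f (s, j, false, t) ≠ extPartner (s, j, false, t) :=
            fun h' ↦ extPartner_ne_inner s false t t' j (h'.symm.trans ht)
          have hiff := h s j false
          obtain rfl : t = t₀ := by
            cases t <;> cases t₀ <;> first | rfl | exact (hne (hiff.2 h₀)).elim |
              exact (h₀ (hiff.2 hne)).elim
          simpa [ht] using h₁
        refine ⟨!(t₀ ^^ t₁), fun e t ht ↦ ?_⟩
        cases e
        · obtain ⟨rfl, h₂⟩ := huniq _ _ ht
          cases t <;> cases t₁ <;> simp at h₂
        · have hback := congrArg f ht
          rw [hf, Bool.not_true] at hback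
          obtain ⟨h₂, rfl⟩ := huniq _ _ hback.symm
          cases t <;> cases t₀ <;> simp at h₂
      choose q hq using hmiss
      refine ⟨fun s j ↦ if h : j < n then q s ⟨j, h⟩ else false, ?_⟩
      rintro ⟨s, j, e, t⟩
      simpa [blockPartner] using (hq s j e t).symm
    obtain ⟨p, hp⟩ := hp
    exact ⟨blockPartner p, blockPartner_involutive p, nbr_blockPartner p, fun x ↦ (hp x).symm,
      fun r h₁ h₂ ↦ connected_blockPartner_of_single hN hp h r h₂ h₁⟩

end Papillon

/-! ### Identification of the coordinates with the papillon graph. -/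

namespace Papillon

variable {n : ℕ}

/-- The vertex with the given coordinates. -/
def ofCoord : Coord n → Vertex n n
  | (s, j, e, t) =>
    let k := cond s 0 n + j
    have hk : k < 2 * n := by cases s <;> simp only [k, cond] <;> omega
    if t then .inl ⟨2 * k + e.toNat, by have := e.toNat_le; omega⟩
    -- The negation puts opposite corners, such as `u_{2i-1}` and `v_{2i}`, at the same end.
    else .inr ⟨2 * k + (!e).toNat, by have := (!e).toNat_le; omega⟩

theorem ofCoord_injective : Function.Injective (ofCoord (n := n)) := by
  rintro ⟨s, ⟨j, hj⟩, e, t⟩ ⟨s', ⟨j', hj'⟩, e', t'⟩ h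
  cases t <;> cases t' <;> simp [ofCoord] at h
  all_goals
    cases s <;> cases s' <;> cases e <;> cases e' <;> simp [Fin.ext_iff] at h ⊢ <;> omega

theorem ofCoord_bijective : Function.Bijective (ofCoord (n := n)) := by
  rw [Fintype.bijective_iff_injective_and_card]
  refine ⟨ofCoord_injective, ?_⟩
  simp [Vertex]
  ring

/-- Zero-based and free of existentials, so that `omega` can settle adjacency. -/
theorem innerEdge_succ_iff (hn : 0 < n) (a b : ℕ) :
    InnerEdge n n (a + 1) (b + 1) ↔
      (a % 2 = 0 ∧ b = a + 1 ∧ a + 2 ≤ 4 * n) ∨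
      (a % 2 = 0 ∧ b = a + 3 ∧ a + 4 ≤ 4 * n ∧ a + 2 ≠ 2 * n) ∨
      (a = 1 ∧ b = 2 * n + 1) ∨ (a + 2 = 2 * n ∧ b + 2 = 4 * n) := by
  simp only [InnerEdge, min_self]
  constructor
  · rintro (⟨i, h⟩ | ⟨i, h⟩ | h | h) <;> omega
  · rintro (h | h | h | h)
    · exact Or.inl ⟨a / 2 + 1, by omega⟩
    · exact Or.inr (Or.inl ⟨a / 2 + 1, by omega⟩)
    · omega
    · omega

set_option maxHeartbeats 1000000 in
theorem adj_ofCoord_iff (hn : 2 ≤ n) (x y : Coord n) :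
    (balancedPapillonGraph n).Adj (ofCoord x) (ofCoord y) ↔ Nbr x y := by
  obtain ⟨s, ⟨j, hj⟩, e, t⟩ := x
  obtain ⟨s', ⟨j', hj'⟩, e', t'⟩ := y
  rw [balancedPapillonGraph, papillonGraph, SimpleGraph.fromRel_adj, ofCoord_injective.ne_iff]
  have hn' : 0 < n := by omega
  cases t <;> cases t' <;> cases e <;> cases e' <;>
    simp only [ofCoord, EdgeRel, OuterEdge, innerEdge_succ_iff hn', Nbr, extPartner,
      Bool.false_eq_true, if_true, if_false] <;>
    split_ifs <;> cases s <;> cases s' <;>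
    simp [Fin.ext_iff] <;> omega

end Papillon

theorem mainTheorem1 (n : ℕ) (hpos : 0 < n) (heven : Even n) :
    (balancedPapillonGraph n).IsPMH := by
  have hn : 2 ≤ n := by obtain ⟨m, rfl⟩ := heven; omega
  let φ := Equiv.ofBijective _ (Papillon.ofCoord_bijective (n := n))
  have hφ : ∀ x y, (balancedPapillonGraph n).Adj (φ x) (φ y) ↔ Papillon.Nbr x y :=
    Papillon.adj_ofCoord_iff hn
  have : Nonempty (Papillon.Vertex n n) := ⟨φ (true, ⟨0, hpos⟩, true, true)⟩
  refine SimpleGraph.isPMH_of_involutions ⟨φ ∘ Papillon.extPartner ∘ φ.symm, ?_, ?_⟩ ?_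
  · intro v
    simp [Papillon.extPartner_involutive _]
  · intro v
    obtain ⟨x, rfl⟩ := φ.surjective v
    simpa using (hφ _ _).2 (Or.inl rfl)
  · intro f hf hadj
    obtain ⟨g, hg, hgN, hne, hconn⟩ := Papillon.exists_complementary_involution hpos heven
      (f := φ.symm ∘ f ∘ φ) (fun x ↦ by simp [hf _]) (fun x ↦ (hφ _ _).1 (by simpa using hadj _))
    refine ⟨φ ∘ g ∘ φ.symm, fun v ↦ by simp [hg _], fun v ↦ ?_, fun v h ↦ ?_, fun r hrf hrg ↦ ?_⟩
    · obtain ⟨x, rfl⟩ := φ.surjective v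
      simpa using (hφ _ _).2 (hgN x)
    · exact hne (φ.symm v) (by simp [h])
    · intro v w
      have := hconn (r.comap φ) (fun x ↦ by simpa [Setoid.comap_rel] using hrf (φ x))
        (fun x ↦ by simpa [Setoid.comap_rel] using hrg (φ x)) (φ.symm v) (φ.symm w)
      simpa [Setoid.comap_rel] using this
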